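/- Let $n\ge 1$ and let $F$ denote the frequency on subsets of $\mathbb Z^n$. For $N\ge 1$ let $\mathcal P_N$ be the class of boxes $P=\{x\in\mathbb Z^n: a_k\le x_k<a_k+\ell_k,\ 1\le k\le n\}$ with $a\in\mathbb Z^n$ and integers $\ell_k\ge N$; a set $A\subset\mathbb Z^n$ is frequency measurable if $$\sup_{N\ge1}\inf_{P\in\mathcal P_N}\frac{\#(A\cap P)}{\#P}=\inf_{N\ge1}\sup_{P\in\mathcal P_N}\frac{\#(A\cap P)}{\#P},$$ and then $F(A)$ is this common value. For $\Lambda\in\mathbb R^{m\times n}$ let $\mathcal Q_m(\Lambda)$ be the class of all sets $\{x\in\mathbb Z^n:\Lambda x\in G+\mathbb Z^m\}$ with $G\subset[0,1)^m$ Jordan measurable (bounded with Lebesgue null boundary). $\Lambda$ is called nonresonant if the $n+m$ rows of $\begin{bmatrix}I_n\\ \Lambda\end{bmatrix}$ are linearly independent over $\mathbb Q$. A nonsingular matrix $L\in\mathbb R^{n\times n}$ is called iteratively nonresonant if every matrix formed from finitely many (and at least one) distinct rows of the infinite matrix obtained by stacking all the powers $L^k$, $k\in\mathbb Z\setminus\{0\}$,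 is nonresonant. Let $\mathcal Q^+$ be the union of the classes $\mathcal Q_m(\Lambda)$ over all $m\ge1$ and all $m\times n$ matrices $\Lambda$ formed from $m$ distinct rows of the infinite matrix obtained by stacking $L,L^2,L^3,\dots$, and let $\mathcal Q_N^+=\mathcal Q_{Nn}(\Lambda)$ with $\Lambda$ the matrix obtained by stacking $L,L^2,\dots,L^N$. Let $R:\mathbb R^n\to\mathbb Z^n$ be a quantizer, that is, $R(u+z)=R(u)+z$ for all $u\in\mathbb R^n$, $z\in\mathbb Z^n$, and $R^{-1}(0)$ is Jordan measurable. Let $T:\mathbb Z^n\to\mathbb Z^n$, $T(x)=R(Lx)$, and let $T^{-k}(A)=\{x\in\mathbb Z^n:T^k(x)\in A\}$. **Theorem (mixing).** Suppose that $L$ is iteratively nonresonant. Then for all $A,B\in\mathcal Q^+$ the sets $A$, $B$ and $T^{-k}(A)\cap B$ ($k\ge0$) are frequency measurable, and $$\lim_{k\to\infty}F\big(T^{-k}(A)\cap B\big)=F(A)\,F(B).$$ Moreover, for any $A,B\in\mathcal Q^+$ there is $N\ge1$ with $A,B\in\mathcal Q_N^+$; and for every $N\ge1$ and all $A,B\in\mathcal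 Q_N^+$, the sets $A$, $B$ and $T^{-k}(A)\cap B$ are frequency measurable and $$F\big(T^{-k}(A)\cap B\big)=F(A)\,F(B)\qquad\text{for all } k\ge N.$$ -/

import Mathlib

namespace QuantizedLinear

/-! ### Frequency of subsets of the lattice -/

/-- The discrete parallelepiped `{x ∈ ℤⁿ : a k ≤ x k < a k + ℓ k for all k}`. -/
noncomputable def box {n : ℕ} (a : Fin n → ℤ) (ℓ : Fin n → ℕ) : Finset (Fin n → ℤ) :=
  Fintype.piFinset fun k => Finset.Ico (a k) (a k + (ℓ k : ℤ))

/-- The class of discrete parallelepipeds all of whose edge lengths are at least `N`. -/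
def largeBoxes (n N : ℕ) : Set (Finset (Fin n → ℤ)) :=
  {P | ∃ (a : Fin n → ℤ) (ℓ : Fin n → ℕ), (∀ k, N ≤ ℓ k) ∧ P = box a ℓ}

/-- The fraction `#(A ∩ P) / #P` of points of the finite set `P` that lie in `A`. -/
noncomputable def fraction {n : ℕ} (A : Set (Fin n → ℤ)) (P : Finset (Fin n → ℤ)) : ℝ :=
  ((A ∩ (P : Set (Fin n → ℤ))).ncard : ℝ) / (P.card : ℝ)

/-- The lower frequency `sup_{N ≥ 1} inf_{P ∈ 𝒫_N} #(A ∩ P) / #P`. -/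
noncomputable def lowerFrequency {n : ℕ} (A : Set (Fin n → ℤ)) : ℝ :=
  ⨆ N : ℕ+, ⨅ P : largeBoxes n (N : ℕ), fraction A P.1

/-- The upper frequency `inf_{N ≥ 1} sup_{P ∈ 𝒫_N} #(A ∩ P) / #P`. -/
noncomputable def upperFrequency {n : ℕ} (A : Set (Fin n → ℤ)) : ℝ :=
  ⨅ N : ℕ+, ⨆ P : largeBoxes n (N : ℕ), fraction A P.1

/-- A set is frequency measurable if its lower and upper frequencies coincide. -/
def FrequencyMeasurable {n : ℕ} (A : Set (Fin n → ℤ)) : Prop :=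
  lowerFrequency A = upperFrequency A

/-- The frequency of a frequency measurable set: the common value of the lower and the upper
frequency. (It is meaningful only together with `FrequencyMeasurable A`.) -/
noncomputable def frequency {n : ℕ} (A : Set (Fin n → ℤ)) : ℝ :=
  upperFrequency A

/-! ### Quasiperiodic sets -/

/-- The inclusion `ℤ^ι ⊆ ℝ^ι`. -/
def toReal {ι : Type*} (z : ι → ℤ) : ι → ℝ := fun i => (z i : ℝ)

/-- Jordan measurability: boundedness together with a Lebesgue null boundary. -/
def JordanMeasurable {ι : Type*} [Fintype ι] (G : Set (ι → ℝ)) : Prop :=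
  Bornology.IsBounded G ∧ MeasureTheory.volume (frontier G) = 0

/-- The half-open unit cube `[0,1)^ι`. -/
def unitCube (ι : Type*) : Set (ι → ℝ) := Set.univ.pi fun _ => Set.Ico (0 : ℝ) 1

/-- The set `{x ∈ ℤⁿ : Λ x ∈ G + ℤ^ι}`. -/
def quasiperiodicSet {n : ℕ} {ι : Type*} (G : Set (ι → ℝ)) (Λ : Matrix ι (Fin n) ℝ) :
    Set (Fin n → ℤ) :=
  {x | ∃ g ∈ G, ∃ z : ι → ℤ, Λ.mulVec (toReal x) = g + toReal z}

/-- The algebra of `Λ`-quasiperiodic subsets of the lattice, for a matrix `Λ` with finitely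
many rows. -/
def quasiperiodicAlgebra {n : ℕ} {ι : Type*} [Fintype ι] (Λ : Matrix ι (Fin n) ℝ) :
    Set (Set (Fin n → ℤ)) :=
  {A | ∃ G : Set (ι → ℝ), G ⊆ unitCube ι ∧ JordanMeasurable G ∧ A = quasiperiodicSet G Λ}

/-- The algebra of `ℒ`-quasiperiodic subsets of the lattice, for a matrix `ℒ` with possibly
infinitely many rows: the union of the algebras of all submatrices formed from `m ≥ 1`
(distinct) rows of `ℒ`. -/
def infQuasiperiodicAlgebra {n : ℕ} {κ : Type*} (ℒ : Matrix κ (Fin n) ℝ) :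
    Set (Set (Fin n → ℤ)) :=
  {A | ∃ m : ℕ, 1 ≤ m ∧ ∃ e : Fin m ↪ κ, A ∈ quasiperiodicAlgebra (ℒ.submatrix e id)}

/-! ### Nonresonance -/

/-- `Λ` is nonresonant if the rows of the identity matrix stacked on `Λ` are linearly
independent over the rationals. -/
def Nonresonant {n : ℕ} {ι : Type*} (Λ : Matrix ι (Fin n) ℝ) : Prop :=
  LinearIndependent ℚ (Matrix.fromRows (1 : Matrix (Fin n) (Fin n) ℝ) Λ).row

/-- A matrix with infinitely many rows is nonresonant if all its submatrices formed from
finitely many (distinct) rows are. -/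
def InfNonresonant {n : ℕ} {κ : Type*} (ℒ : Matrix κ (Fin n) ℝ) : Prop :=
  ∀ m : ℕ, 1 ≤ m → ∀ e : Fin m ↪ κ, Nonresonant (ℒ.submatrix e id)

/-- All nonzero integer powers of `L`, stacked on each other. -/
noncomputable def powerMatrix {n : ℕ} (L : Matrix (Fin n) (Fin n) ℝ) :
    Matrix ({k : ℤ // k ≠ 0} × Fin n) (Fin n) ℝ :=
  Matrix.of fun p j => (L ^ (p.1 : ℤ)) p.2 j

/-- All positive integer powers of `L`, stacked on each other. -/
def forwardMatrix {n : ℕ} (L : Matrix (Fin n) (Fin n) ℝ) :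
    Matrix (ℕ+ × Fin n) (Fin n) ℝ :=
  Matrix.of fun p j => (L ^ (p.1 : ℕ)) p.2 j

/-- The powers `L, L², …, L^N`, stacked on each other. -/
def forwardBlock {n : ℕ} (L : Matrix (Fin n) (Fin n) ℝ) (N : ℕ) :
    Matrix (Fin N × Fin n) (Fin n) ℝ :=
  Matrix.of fun p j => (L ^ ((p.1 : ℕ) + 1)) p.2 j

/-- A nonsingular matrix is iteratively nonresonant if the matrix formed from all its nonzero
integer powers is nonresonant. -/
def IterativelyNonresonant {n : ℕ} (L : Matrix (Fin n) (Fin n) ℝ) : Prop :=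
  L.det ≠ 0 ∧ InfNonresonant (powerMatrix L)

/-- The forward algebra `𝒬⁺`. -/
def forwardAlgebra {n : ℕ} (L : Matrix (Fin n) (Fin n) ℝ) : Set (Set (Fin n → ℤ)) :=
  infQuasiperiodicAlgebra (forwardMatrix L)

/-- The algebra `𝒬⁺_N`. -/
def forwardAlgebraUpTo {n : ℕ} (L : Matrix (Fin n) (Fin n) ℝ) (N : ℕ) :
    Set (Set (Fin n → ℤ)) :=
  quasiperiodicAlgebra (forwardBlock L N)

/-! ### Quantized linear systems -/

/-- A quantizer: a map `ℝⁿ → ℤⁿ` that commutes with the translations of the lattice and whose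
cell `R⁻¹(0)` is Jordan measurable. -/
structure IsQuantizer {n : ℕ} (R : (Fin n → ℝ) → (Fin n → ℤ)) : Prop where
  map_add : ∀ (u : Fin n → ℝ) (z : Fin n → ℤ), R (u + toReal z) = R u + z
  jordan : JordanMeasurable (R ⁻¹' {0})

/-- The transition operator `T = R ∘ L` on the lattice. -/
def transition {n : ℕ} (R : (Fin n → ℝ) → (Fin n → ℤ)) (L : Matrix (Fin n) (Fin n) ℝ) :
    (Fin n → ℤ) → (Fin n → ℤ) :=
  fun x => R (L.mulVec (toReal x))

end QuantizedLinear

/-!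
The frequencies of the sets in question are Haar measures of subsets of tori, and mixing is a
statement about a skew shift on a torus.

* *Equidistribution.* If `Λ` is nonresonant, then every nontrivial character of the torus, evaluated
  along `x ↦ Λ x mod 1`, is a nontrivial character of `ℤⁿ`, whose averages over large boxes tend
  to zero uniformly in the position of the box (`tendsto_average_character`). By density of the
  exponential monomials and the portmanteau theorem, `{x | Λ x mod 1 ∈ E}` has the Haar measure of
  `E` as its frequency whenever `E` has null boundary (`hasUniformFrequency_of_nonresonant`).
  Jordan measurable sets `G` give such sets `E`.

* *The skew shift.* The quantization error `u - R u` is a function of `u mod 1`, continuous almost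
  everywhere. Hence `y x = (L x, L² x, …) mod 1` satisfies `y (T x) = S (y x)`, where
  `(S u) j = u (j + 1) - Lʲ⁺¹ e (u 0)` and `e` is the quantization error
  (`IsQuantizer.semiconj_orbitSeq`). So `T⁻ᵏ A` is again the set of visits of `y` to a subset of a
  torus, the preimage under `Sᵏ` of the one for `A`.

* *Independence.* Adding `s` to the coordinates of index at least `k` adds the shifted `s` to the
  value of `Sᵏ`, because `Sᵏ` subtracts from these coordinates a function of the first `k` ones
  (`skewShift_iterate_add`). Averaging over all such `s` shows that `Sᵏ` transports Haar measure to
  Haar measure and is independent of the first `k` coordinates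
  (`measure_inter_preimage_of_equivariant`). The first fact implies, by induction on `k`, that `Sᵏ`
  is continuous almost everywhere (`IsQuantizer.ae_continuousAt_iterate`), so that null boundaries
  are preserved and all the sets `T⁻ᵏ A ∩ B` have a frequency. The second fact gives
  `F (T⁻ᵏ A ∩ B) = F A * F B` once `B` depends on the first `N ≤ k` coordinates only.
-/

namespace QuantizedLinear

open MeasureTheory Filter Topology
open scoped ENNReal

/-! ### Uniform averages over large boxes -/

/-- The filter on pairs `(a, ℓ)` along which all edge lengths `ℓ k` tend to infinity, uniformly in
the corner `a`. -/
def boxFilter (n : ℕ) : Filter ((Fin n → ℤ) × (Fin n → ℕ)) := ⊤ ×ˢ atTop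

instance (n : ℕ) : (boxFilter n).NeBot := by unfold boxFilter; infer_instance

/-- The box with corner `p.1` and edge lengths `p.2 k + 1`; the shift keeps it nonempty. -/
noncomputable def boxOf {n : ℕ} (p : (Fin n → ℤ) × (Fin n → ℕ)) : Finset (Fin n → ℤ) :=
  box p.1 fun k => p.2 k + 1

/-- The fraction of points of `A` in a box tends to `c` as the edges of the box grow, uniformly in
the position of the box. -/
def HasUniformFrequency {n : ℕ} (A : Set (Fin n → ℤ)) (c : ℝ) : Prop :=
  Tendsto (fun p => fraction A (boxOf p)) (boxFilter n) (𝓝 c)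

lemma card_box {n : ℕ} (a : Fin n → ℤ) (ℓ : Fin n → ℕ) : (box a ℓ).card = ∏ k, ℓ k := by
  simp [box]

lemma card_boxOf {n : ℕ} (p : (Fin n → ℤ) × (Fin n → ℕ)) :
    (boxOf p).card = ∏ k, (p.2 k + 1) := card_box _ _

lemma card_boxOf_pos {n : ℕ} (p : (Fin n → ℤ) × (Fin n → ℕ)) : 0 < (boxOf p).card := by
  rw [card_boxOf]; exact Finset.prod_pos fun _ _ => Nat.succ_pos _

lemma fraction_nonneg {n : ℕ} (A : Set (Fin n → ℤ)) (P : Finset (Fin n → ℤ)) :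
    0 ≤ fraction A P := by unfold fraction; positivity

lemma fraction_le_one {n : ℕ} (A : Set (Fin n → ℤ)) (P : Finset (Fin n → ℤ)) :
    fraction A P ≤ 1 := by
  refine div_le_one_of_le₀ ?_ (by positivity)
  have := Set.ncard_le_ncard (Set.inter_subset_right : A ∩ (P : Set (Fin n → ℤ)) ⊆ P)
    P.finite_toSet
  rw [Set.ncard_coe_finset] at this
  exact_mod_cast this

lemma eventually_boxFilter {n : ℕ} {q : (Fin n → ℤ) × (Fin n → ℕ) → Prop}
    (h : ∀ᶠ p in boxFilter n, q p) : ∃ N : ℕ, ∀ a ℓ, (∀ k, N ≤ ℓ k) → q (a, ℓ) := by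
  obtain ⟨s, hs, t, ht, hst⟩ := Filter.mem_prod_iff.1 h
  rw [Filter.mem_top] at hs
  obtain ⟨b, hb⟩ := Filter.mem_atTop_sets.1 ht
  refine ⟨∑ k, b k, fun a ℓ h => hst ⟨by simp [hs], hb _ fun k => le_trans ?_ (h k)⟩⟩
  exact Finset.single_le_sum (f := b) (fun _ _ => Nat.zero_le _) (Finset.mem_univ k)

lemma HasUniformFrequency.exists_forall_abs_le {n : ℕ} {A : Set (Fin n → ℤ)} {c : ℝ}
    (h : HasUniformFrequency A c) {ε : ℝ} (hε : 0 < ε) :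
    ∃ N : ℕ+, ∀ P ∈ largeBoxes n N, |fraction A P - c| ≤ ε := by
  obtain ⟨N, hN⟩ := eventually_boxFilter ((Metric.tendsto_nhds.1 h) ε hε)
  refine ⟨N.succPNat, ?_⟩
  rintro P ⟨a, ℓ, hℓ, rfl⟩
  have hℓ' : ∀ k, N + 1 ≤ ℓ k := hℓ
  have := hN a (fun k => ℓ k - 1) (fun k => by have := hℓ' k; omega)
  have hb : boxOf (a, fun k => ℓ k - 1) = box a ℓ := by
    unfold boxOf
    congr 1
    funext k
    have := hℓ' k
    simp only
    omega
  rw [hb, Real.dist_eq] at this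
  exact this.le

/-- The filter formulation of the frequency agrees with the definition through lower and upper
frequencies. -/
theorem HasUniformFrequency.frequency {n : ℕ} {A : Set (Fin n → ℤ)} {c : ℝ}
    (h : HasUniformFrequency A c) : FrequencyMeasurable A ∧ frequency A = c := by
  have hne : ∀ N : ℕ, Nonempty (largeBoxes n N) := fun N =>
    ⟨⟨_, 0, fun _ => N, fun _ => le_rfl, rfl⟩⟩
  have hmono : ∀ {M N : ℕ}, M ≤ N → largeBoxes n N ⊆ largeBoxes n M := by
    rintro M N hMN P ⟨a, ℓ, hℓ, rfl⟩
    exact ⟨a, ℓ, fun k => hMN.trans (hℓ k), rfl⟩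
  have hbb : ∀ N : ℕ, BddBelow (Set.range fun P : largeBoxes n N => fraction A P.1) := fun N =>
    ⟨0, by rintro _ ⟨P, rfl⟩; exact fraction_nonneg _ _⟩
  have hba : ∀ N : ℕ, BddAbove (Set.range fun P : largeBoxes n N => fraction A P.1) := fun N =>
    ⟨1, by rintro _ ⟨P, rfl⟩; exact fraction_le_one _ _⟩
  -- for all `M`, some box occurs both in the class for `M` and far out in the limit
  have hcommon : ∀ (M N : ℕ), ∃ P, P ∈ largeBoxes n M ∧ P ∈ largeBoxes n N := fun M N =>
    let ⟨P⟩ := hne (max M N)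
    ⟨P.1, hmono (le_max_left _ _) P.2, hmono (le_max_right _ _) P.2⟩
  have hlow : lowerFrequency A = c := by
    apply le_antisymm
    · refine ciSup_le fun M => le_of_forall_pos_le_add fun ε hε => ?_
      obtain ⟨N, hN⟩ := h.exists_forall_abs_le hε
      obtain ⟨P, hPM, hPN⟩ := hcommon M N
      refine (ciInf_le (hbb M) ⟨P, hPM⟩).trans ?_
      have := abs_le.1 (hN P hPN)
      simp only
      linarith
    · refine le_of_forall_pos_le_add fun ε hε => ?_
      obtain ⟨N, hN⟩ := h.exists_forall_abs_le hε
      have h1 : c - ε ≤ ⨅ P : largeBoxes n (N : ℕ), fraction A P.1 := by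
        have := hne N
        refine le_ciInf fun P => ?_
        have := abs_le.1 (hN P.1 P.2)
        linarith
      have h2 : (⨅ P : largeBoxes n (N : ℕ), fraction A P.1) ≤ lowerFrequency A := by
        refine le_ciSup (f := fun N : ℕ+ => ⨅ P : largeBoxes n (N : ℕ), fraction A P.1) ⟨1, ?_⟩ N
        rintro _ ⟨M, rfl⟩
        obtain ⟨P⟩ := hne M
        exact (ciInf_le (hbb M) P).trans (fraction_le_one _ _)
      linarith
  have hup : upperFrequency A = c := by
    apply le_antisymm
    · refine le_of_forall_pos_le_add fun ε hε => ?_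
      obtain ⟨N, hN⟩ := h.exists_forall_abs_le hε
      have h1 : (⨆ P : largeBoxes n (N : ℕ), fraction A P.1) ≤ c + ε := by
        have := hne N
        refine ciSup_le fun P => ?_
        have := abs_le.1 (hN P.1 P.2)
        linarith
      have h2 : upperFrequency A ≤ (⨆ P : largeBoxes n (N : ℕ), fraction A P.1) := by
        refine ciInf_le (f := fun N : ℕ+ => ⨆ P : largeBoxes n (N : ℕ), fraction A P.1) ⟨0, ?_⟩ N
        rintro _ ⟨M, rfl⟩
        obtain ⟨P⟩ := hne M
        exact (fraction_nonneg _ _).trans (le_ciSup (hba M) P)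
      linarith
    · refine le_ciInf fun M => ?_
      refine le_of_forall_pos_le_add fun ε hε => ?_
      obtain ⟨N, hN⟩ := h.exists_forall_abs_le hε
      obtain ⟨P, hPM, hPN⟩ := hcommon M N
      have h1 := le_ciSup (hba M) ⟨P, hPM⟩
      have := abs_le.1 (hN P hPN)
      simp only at h1
      linarith
  exact ⟨hlow.trans hup.symm, hup⟩

/-! ### Exponential sums over boxes -/

/-- The average of `f` over the finite set `P`. -/
noncomputable def average {n : ℕ} (f : (Fin n → ℤ) → ℂ) (P : Finset (Fin n → ℤ)) : ℂ :=
  (P.card : ℂ)⁻¹ * ∑ x ∈ P, f x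

lemma norm_average_le {n : ℕ} {f : (Fin n → ℤ) → ℂ} {C : ℝ} (hC : 0 ≤ C) (hf : ∀ x, ‖f x‖ ≤ C)
    (P : Finset (Fin n → ℤ)) : ‖average f P‖ ≤ C := by
  rcases P.eq_empty_or_nonempty with rfl | hP
  · simpa [average] using hC
  have hc : (0 : ℝ) < P.card := by exact_mod_cast hP.card_pos
  unfold average
  rw [norm_mul, norm_inv, Complex.norm_natCast, inv_mul_le_iff₀ hc]
  refine (norm_sum_le _ _).trans ((Finset.sum_le_sum fun x _ => hf x).trans ?_)
  simp

lemma sub_one_mul_sum_Ico_zpow {w : ℂ} (hw : w ≠ 0) (a : ℤ) (m : ℕ) :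
    (w - 1) * ∑ t ∈ Finset.Ico a (a + m), w ^ t = w ^ (a + m) - w ^ a := by
  induction m with
  | zero => simp
  | succ m ih =>
    have : Finset.Ico a (a + (m + 1 : ℕ)) = insert (a + (m : ℤ)) (Finset.Ico a (a + m)) := by
      ext t; simp only [Finset.mem_Ico, Finset.mem_insert]; push_cast; omega
    rw [this, Finset.sum_insert (by simp), mul_add, ih]
    push_cast
    rw [← add_assoc, zpow_add_one₀ hw]
    ring

lemma norm_sum_Ico_zpow_le {w : ℂ} (hw : ‖w‖ = 1) (h1 : w ≠ 1) (a : ℤ) (m : ℕ) :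
    ‖∑ t ∈ Finset.Ico a (a + m), w ^ t‖ ≤ 2 / ‖w - 1‖ := by
  have hw0 : w ≠ 0 := by rintro rfl; simp at hw
  rw [le_div_iff₀ (norm_pos_iff.2 (sub_ne_zero.2 h1)), mul_comm, ← norm_mul,
    sub_one_mul_sum_Ico_zpow hw0]
  refine (norm_sub_le _ _).trans ?_
  simp [norm_zpow, hw]; norm_num

/-- Averages of a nontrivial character of `ℤⁿ` tend to zero: the sum over a box is a product of
geometric sums, one of which is bounded. -/
lemma tendsto_average_character {n : ℕ} (w : Fin n → ℂ) (hw : ∀ j, ‖w j‖ = 1) (j₀ : Fin n)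
    (h1 : w j₀ ≠ 1) :
    Tendsto (fun p => average (fun x => ∏ j, w j ^ x j) (boxOf p)) (boxFilter n) (𝓝 0) := by
  have key : ∀ p : (Fin n → ℤ) × (Fin n → ℕ),
      ‖average (fun x => ∏ j, w j ^ x j) (boxOf p)‖ ≤ (2 / ‖w j₀ - 1‖) / ((p.2 j₀ : ℝ) + 1) := by
    intro p
    have h2 : average (fun x => ∏ j, w j ^ x j) (boxOf p) =
        ∏ j, (((p.2 j + 1 : ℕ) : ℂ)⁻¹ *
          ∑ t ∈ Finset.Ico (p.1 j) (p.1 j + (p.2 j + 1 : ℕ)), w j ^ t) := by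
      unfold average
      rw [card_boxOf, boxOf, box, ← Finset.prod_univ_sum, Finset.prod_mul_distrib]
      push_cast
      rw [Finset.prod_inv_distrib]
    rw [h2, norm_prod, ← Finset.mul_prod_erase _ _ (Finset.mem_univ j₀)]
    refine (mul_le_of_le_one_right (norm_nonneg _) ?_).trans ?_
    · refine Finset.prod_le_one (fun _ _ => norm_nonneg _) fun j _ => ?_
      rw [norm_mul, norm_inv, Complex.norm_natCast, inv_mul_le_iff₀ (by positivity), mul_one]
      refine (norm_sum_le _ _).trans ?_
      simp [norm_zpow, hw]
    · rw [norm_mul, norm_inv, Complex.norm_natCast, inv_mul_eq_div]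
      push_cast
      gcongr
      have := norm_sum_Ico_zpow_le (hw j₀) h1 (p.1 j₀) (p.2 j₀ + 1)
      push_cast at this
      exact this
  refine squeeze_zero_norm key ?_
  refine Tendsto.div_atTop tendsto_const_nhds (tendsto_atTop_add_const_right _ _ ?_)
  refine tendsto_natCast_atTop_atTop.comp ?_
  have : Tendsto (fun ℓ : Fin n → ℕ => ℓ j₀) atTop atTop := by
    refine tendsto_atTop.2 fun b => ?_
    filter_upwards [eventually_ge_atTop (fun _ => b)] with ℓ hℓ using hℓ j₀
  exact this.comp tendsto_snd

/-! ### Equidistribution on the torus -/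

/-- The normalized Haar measure of the torus `(ℝ/ℤ)^ι`. -/
noncomputable abbrev torusHaar (ι : Type*) [Fintype ι] : Measure (UnitAddTorus ι) :=
  Measure.pi fun _ : ι => (AddCircle.haarAddCircle : Measure UnitAddCircle)

/-- The covering map `ℝ^ι → (ℝ/ℤ)^ι`. -/
def torusMk {ι : Type*} (v : ι → ℝ) : UnitAddTorus ι := fun i => (v i : UnitAddCircle)

lemma integral_mFourier {ι : Type*} [Fintype ι] {c : ι → ℤ} (hc : c ≠ 0) :
    ∫ t, UnitAddTorus.mFourier c t ∂torusHaar ι = 0 := by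
  obtain ⟨i, hi⟩ := Function.ne_iff.1 hc
  have h := integral_fintype_prod_eq_prod (𝕜 := ℂ)
    (μ := fun _ : ι => (AddCircle.haarAddCircle : Measure UnitAddCircle))
    (fun (i : ι) (t : UnitAddCircle) => (fourier (c i) t : ℂ))
  refine Eq.trans h (Finset.prod_eq_zero (Finset.mem_univ i) ?_)
  exact integral_eq_zero_of_add_right_eq_neg (fourier_add_half_inv_index hi one_pos)

/-- A character of the torus, evaluated along the orbit `x ↦ Λ x mod 1`, is a character of `ℤⁿ`. -/
lemma mFourier_torusMk_mulVec {n : ℕ} {ι : Type*} [Fintype ι] (Λ : Matrix ι (Fin n) ℝ)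
    (c : ι → ℤ) (x : Fin n → ℤ) :
    UnitAddTorus.mFourier c (torusMk (Λ.mulVec (toReal x))) =
      ∏ j, Complex.exp (2 * Real.pi * Complex.I * (∑ i, c i * Λ i j : ℝ)) ^ x j := by
  have h1 : UnitAddTorus.mFourier c (torusMk (Λ.mulVec (toReal x))) =
      ∏ i, fourier (c i) ((Λ.mulVec (toReal x) i : ℝ) : UnitAddCircle) := rfl
  simp_rw [h1, fourier_coe_apply, ← Complex.exp_int_mul, ← Complex.exp_sum]
  congr 1
  simp only [Matrix.mulVec, dotProduct, toReal]
  push_cast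
  simp only [div_one, Finset.mul_sum]
  rw [Finset.sum_comm]
  refine Finset.sum_congr rfl fun j _ => Finset.sum_congr rfl fun i _ => by ring

lemma exists_exp_ne_one_of_nonresonant {n : ℕ} {ι : Type*} [Fintype ι] {Λ : Matrix ι (Fin n) ℝ}
    (hΛ : Nonresonant Λ) {c : ι → ℤ} (hc : c ≠ 0) :
    ∃ j, Complex.exp (2 * Real.pi * Complex.I * (∑ i, c i * Λ i j : ℝ)) ≠ 1 := by
  by_contra! h
  have h2 : ∀ j, ∃ p : ℤ, ∑ i, (c i : ℝ) * Λ i j = p := by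
    intro j
    obtain ⟨p, hp⟩ := Complex.exp_eq_one_iff.1 (h j)
    refine ⟨p, ?_⟩
    have hne : (2 * Real.pi * Complex.I : ℂ) ≠ 0 := Complex.two_pi_I_ne_zero
    rw [mul_comm] at hp
    exact_mod_cast mul_right_cancel₀ hne hp
  choose p hp using h2
  have hli := Fintype.linearIndependent_iff.1 hΛ (Sum.elim (fun j => -(p j : ℚ)) fun i => (c i : ℚ))
    (by
      ext j
      have := hp j
      have h1 : ∀ k, (Matrix.fromRows (1 : Matrix (Fin n) (Fin n) ℝ) Λ) (Sum.inl k) j =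
          if k = j then 1 else 0 := fun k => by simp [Matrix.one_apply]
      have h2 : ∀ i, (Matrix.fromRows (1 : Matrix (Fin n) (Fin n) ℝ) Λ) (Sum.inr i) j = Λ i j :=
        fun _ => rfl
      simp [Matrix.row, Finset.sum_apply, Rat.smul_def, h1, h2, this])
  obtain ⟨i, hi⟩ := Function.ne_iff.1 hc
  exact hi (by simpa using hli (Sum.inr i))

/-- Weyl's criterion, on continuous functions: the orbit averages of a continuous function converge
to its integral, because this holds for the exponential monomials, whose span is dense. -/
lemma tendsto_average_continuous {n : ℕ} {ι : Type*} [Fintype ι] {Λ : Matrix ι (Fin n) ℝ}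
    (hΛ : Nonresonant Λ) (f : C(UnitAddTorus ι, ℂ)) :
    Tendsto (fun p => average (fun x => f (torusMk (Λ.mulVec (toReal x)))) (boxOf p))
      (boxFilter n) (𝓝 (∫ t, f t ∂torusHaar ι)) := by
  have hint : ∀ g : C(UnitAddTorus ι, ℂ), Integrable (fun t => g t) (torusHaar ι) := fun g =>
    g.continuous.integrable_of_hasCompactSupport (HasCompactSupport.of_compactSpace _)
  have hmono : ∀ c : ι → ℤ, Tendsto (fun p => average (fun x =>
      UnitAddTorus.mFourier c (torusMk (Λ.mulVec (toReal x)))) (boxOf p))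
      (boxFilter n) (𝓝 (∫ t, UnitAddTorus.mFourier c t ∂torusHaar ι)) := by
    intro c
    by_cases hc : c = 0
    · subst hc
      have : ∀ p : (Fin n → ℤ) × (Fin n → ℕ), average (fun x =>
          UnitAddTorus.mFourier (0 : ι → ℤ) (torusMk (Λ.mulVec (toReal x)))) (boxOf p) = 1 := by
        intro p
        have := (card_boxOf_pos p).ne'
        simp [average, UnitAddTorus.mFourier_zero, this]
      simp_rw [this]
      simp [UnitAddTorus.mFourier_zero]
    · rw [integral_mFourier hc]
      obtain ⟨j, hj⟩ := exists_exp_ne_one_of_nonresonant hΛ hc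
      simp_rw [mFourier_torusMk_mulVec]
      refine tendsto_average_character _ (fun j => ?_) j hj
      have : (2 * Real.pi * Complex.I * (∑ i, c i * Λ i j : ℝ) : ℂ) =
        ((2 * Real.pi * ∑ i, c i * Λ i j : ℝ) : ℂ) * Complex.I := by push_cast; ring
      rw [this, Complex.norm_exp_ofReal_mul_I]
  have hspan : ∀ g ∈ Submodule.span ℂ (Set.range (UnitAddTorus.mFourier (d := ι))),
      Tendsto (fun p => average (fun x => g (torusMk (Λ.mulVec (toReal x)))) (boxOf p))
        (boxFilter n) (𝓝 (∫ t, g t ∂torusHaar ι)) := by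
    intro g hg
    induction hg using Submodule.span_induction with
    | mem g hg => obtain ⟨c, rfl⟩ := hg; exact hmono c
    | zero => simp [average]
    | add g h _ _ hg hh =>
      simp only [ContinuousMap.add_apply]
      rw [integral_add (hint g) (hint h)]
      refine (hg.add hh).congr fun p => ?_
      simp [average, Finset.sum_add_distrib, mul_add]
    | smul a g _ hg =>
      simp only [ContinuousMap.smul_apply]
      rw [integral_smul]
      refine (hg.const_smul a).congr fun p => ?_
      simp only [average, smul_eq_mul, Finset.mul_sum]
      exact Finset.sum_congr rfl fun x _ => by ring
  have hf : f ∈ closure (Submodule.span ℂ (Set.range (UnitAddTorus.mFourier (d := ι))) :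
      Set C(UnitAddTorus ι, ℂ)) := by
    rw [← Submodule.topologicalClosure_coe, UnitAddTorus.span_mFourier_closure_eq_top]
    trivial
  rw [Metric.tendsto_nhds]
  intro ε hε
  obtain ⟨g, hg, hfg⟩ := Metric.mem_closure_iff.1 hf (ε / 3) (by positivity)
  have hpt : ∀ t, ‖f t - g t‖ ≤ ε / 3 := fun t => by
    rw [← dist_eq_norm]; exact (ContinuousMap.dist_apply_le_dist t).trans hfg.le
  filter_upwards [Metric.tendsto_nhds.1 (hspan g hg) (ε / 3) (by positivity)] with p hp
  rw [dist_eq_norm] at hp ⊢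
  have h1 : average (fun x => f (torusMk (Λ.mulVec (toReal x)))) (boxOf p) -
      average (fun x => g (torusMk (Λ.mulVec (toReal x)))) (boxOf p) =
      average (fun x => f (torusMk (Λ.mulVec (toReal x))) - g (torusMk (Λ.mulVec (toReal x))))
        (boxOf p) := by
    simp [average, Finset.sum_sub_distrib, mul_sub]
  have h2 := norm_average_le (f := fun x => f (torusMk (Λ.mulVec (toReal x))) -
    g (torusMk (Λ.mulVec (toReal x)))) (by positivity) (fun x => hpt _) (boxOf p)
  rw [← h1] at h2
  have h3 : ‖(∫ t, g t ∂torusHaar ι) - ∫ t, f t ∂torusHaar ι‖ ≤ ε / 3 := by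
    rw [← integral_sub (hint g) (hint f)]
    refine (norm_integral_le_of_norm_le_const (C := ε / 3) (ae_of_all _ fun t => ?_)).trans ?_
    · rw [norm_sub_rev]; exact hpt t
    · simp
  calc _ = ‖(average (fun x => f (torusMk (Λ.mulVec (toReal x)))) (boxOf p) -
        average (fun x => g (torusMk (Λ.mulVec (toReal x)))) (boxOf p)) +
        (average (fun x => g (torusMk (Λ.mulVec (toReal x)))) (boxOf p) - ∫ t, g t ∂torusHaar ι) +
        ((∫ t, g t ∂torusHaar ι) - ∫ t, f t ∂torusHaar ι)‖ := by congr 1; ring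
    _ < ε := by
      refine (norm_add₃_le).trans_lt ?_
      linarith

/-- The uniform distribution on the images under `y` of the points of a nonempty finite set. -/
noncomputable def empiricalMeasure {n : ℕ} {X : Type*} [MeasurableSpace X] (y : (Fin n → ℤ) → X)
    (P : Finset (Fin n → ℤ)) : Measure X :=
  (P.card : ℝ≥0∞)⁻¹ • ∑ x ∈ P, Measure.dirac (y x)

lemma isProbabilityMeasure_empiricalMeasure {n : ℕ} {X : Type*} [MeasurableSpace X]
    (y : (Fin n → ℤ) → X) {P : Finset (Fin n → ℤ)} (hP : 0 < P.card) :
    IsProbabilityMeasure (empiricalMeasure y P) := by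
  constructor
  simp only [empiricalMeasure, Measure.smul_apply, Measure.finsetSum_apply, measure_univ,
    Finset.sum_const, smul_eq_mul, nsmul_eq_mul, mul_one]
  exact ENNReal.inv_mul_cancel (by exact_mod_cast hP.ne') (ENNReal.natCast_ne_top _)

lemma empiricalMeasure_apply {n : ℕ} {X : Type*} [MeasurableSpace X] [MeasurableSingletonClass X]
    (y : (Fin n → ℤ) → X) (P : Finset (Fin n → ℤ)) (E : Set X) :
    (empiricalMeasure y P E).toReal = fraction (y ⁻¹' E) P := by
  classical
  have h : (y ⁻¹' E ∩ (P : Set (Fin n → ℤ))).ncard = ∑ x ∈ P, if y x ∈ E then 1 else 0 := by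
    rw [← Finset.card_filter, ← Set.ncard_coe_finset]
    congr 1
    ext x
    simp [and_comm]
  simp only [empiricalMeasure, Measure.smul_apply, Measure.finsetSum_apply, Measure.dirac_apply,
    fraction, h, smul_eq_mul, ENNReal.toReal_mul, ENNReal.toReal_inv, ENNReal.toReal_natCast]
  rw [div_eq_inv_mul, ENNReal.toReal_sum]
  · push_cast
    congr 1
    refine Finset.sum_congr rfl fun x _ => ?_
    by_cases hx : y x ∈ E <;> simp [hx]
  · intro x _
    by_cases hx : y x ∈ E <;> simp [hx]

lemma integral_empiricalMeasure {n : ℕ} {X : Type*} [MeasurableSpace X]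
    [MeasurableSingletonClass X] (y : (Fin n → ℤ) → X) (P : Finset (Fin n → ℤ)) (f : X → ℝ) :
    ((∫ t, f t ∂empiricalMeasure y P : ℝ) : ℂ) = average (fun x => (f (y x) : ℂ)) P := by
  rw [empiricalMeasure, integral_smul_measure, integral_finsetSum_measure
    (fun x _ => integrable_dirac (by simp))]
  simp [average]

/-- Equidistribution: for nonresonant `Λ`, the frequency of `{x | Λ x mod 1 ∈ E}` is the Haar
measure of `E`, for every `E` with null boundary. -/
theorem hasUniformFrequency_of_nonresonant {n : ℕ} {ι : Type*} [Fintype ι]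
    {Λ : Matrix ι (Fin n) ℝ} (hΛ : Nonresonant Λ) {E : Set (UnitAddTorus ι)}
    (hE : torusHaar ι (frontier E) = 0) :
    HasUniformFrequency {x | torusMk (Λ.mulVec (toReal x)) ∈ E} (torusHaar ι E).toReal := by
  set y : (Fin n → ℤ) → UnitAddTorus ι := fun x => torusMk (Λ.mulVec (toReal x)) with hy
  let μs : (Fin n → ℤ) × (Fin n → ℕ) → ProbabilityMeasure (UnitAddTorus ι) := fun p =>
    ⟨empiricalMeasure y (boxOf p), isProbabilityMeasure_empiricalMeasure y (card_boxOf_pos p)⟩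
  let μ : ProbabilityMeasure (UnitAddTorus ι) := ⟨torusHaar ι, inferInstance⟩
  have hlim : Tendsto μs (boxFilter n) (𝓝 μ) := by
    rw [ProbabilityMeasure.tendsto_iff_forall_integral_tendsto]
    intro f
    let F : C(UnitAddTorus ι, ℂ) := ⟨fun t => (f t : ℂ), by fun_prop⟩
    have h := (Complex.continuous_re.tendsto _).comp (tendsto_average_continuous hΛ F)
    have h2 : (∫ t, F t ∂torusHaar ι).re = ∫ t, f t ∂torusHaar ι := by
      have : (∫ t, F t ∂torusHaar ι) = ((∫ t, f t ∂torusHaar ι : ℝ) : ℂ) := integral_ofReal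
      rw [this, Complex.ofReal_re]
    rw [h2] at h
    refine h.congr fun p => ?_
    change (average (fun x => ((f (y x) : ℝ) : ℂ)) (boxOf p)).re = _
    rw [← integral_empiricalMeasure y (boxOf p) (fun t => f t), Complex.ofReal_re]
    rfl
  have h := ProbabilityMeasure.tendsto_measure_of_null_frontier_of_tendsto' hlim (E := E) hE
  have h' := (ENNReal.tendsto_toReal (measure_ne_top (torusHaar ι) E)).comp h
  refine h'.congr fun p => ?_
  exact empiricalMeasure_apply y (boxOf p) E

/-! ### Jordan measurable sets and the covering map -/

lemma continuous_torusMk {ι : Type*} : Continuous (torusMk : (ι → ℝ) → UnitAddTorus ι) :=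
  continuous_pi fun i => (AddCircle.continuous_mk' 1).comp (continuous_apply i)

lemma isOpenMap_torusMk {ι : Type*} [Finite ι] :
    IsOpenMap (torusMk : (ι → ℝ) → UnitAddTorus ι) :=
  IsOpenMap.piMap (f := fun _ (x : ℝ) => (x : UnitAddCircle))
    (fun _ => QuotientAddGroup.isOpenMap_coe)
    (Eventually.of_forall fun _ => QuotientAddGroup.mk_surjective)

lemma torusMk_surjective {ι : Type*} : Function.Surjective (torusMk : (ι → ℝ) → UnitAddTorus ι) :=
  fun t => by
    choose v hv using fun i => QuotientAddGroup.mk_surjective (t i)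
    exact ⟨v, funext hv⟩

lemma torusMk_sub {ι : Type*} (u v : ι → ℝ) : torusMk (u - v) = torusMk u - torusMk v := rfl

lemma torusMk_eq_iff {ι : Type*} {u v : ι → ℝ} :
    torusMk u = torusMk v ↔ ∃ z : ι → ℤ, u = v + toReal z := by
  constructor
  · intro h
    have h1 : ∀ i, ∃ m : ℤ, (m : ℝ) = u i - v i := fun i => by
      have : ((u i - v i : ℝ) : UnitAddCircle) = 0 := by
        rw [AddCircle.coe_sub, sub_eq_zero]; exact congrFun h i
      obtain ⟨m, hm⟩ := (AddCircle.coe_eq_zero_iff (1 : ℝ)).1 this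
      exact ⟨m, by simpa using hm⟩
    choose z hz using h1
    exact ⟨z, funext fun i => by simp [toReal, hz]⟩
  · rintro ⟨z, rfl⟩
    funext i
    simp [torusMk, toReal]

lemma measurePreserving_torusMk {ι : Type*} [Fintype ι] :
    MeasurePreserving (torusMk : (ι → ℝ) → UnitAddTorus ι)
      ((volume : Measure (ι → ℝ)).restrict (Set.univ.pi fun _ => Set.Ioc (0 : ℝ) (0 + 1)))
      (torusHaar ι) := by
  have h1 : MeasurePreserving (fun x : ℝ => (x : UnitAddCircle))
      (volume.restrict (Set.Ioc (0 : ℝ) (0 + 1))) AddCircle.haarAddCircle := by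
    have := AddCircle.measurePreserving_mk (1 : ℝ) 0
    rwa [AddCircle.volume_eq_smul_haarAddCircle, ENNReal.ofReal_one, one_smul] at this
  have h2 := measurePreserving_pi (fun _ : ι => volume.restrict (Set.Ioc (0 : ℝ) (0 + 1)))
    (fun _ : ι => (AddCircle.haarAddCircle : Measure UnitAddCircle)) (fun _ => h1)
  rwa [← Measure.restrict_pi_pi] at h2

lemma torusHaar_image_torusMk_eq_zero {ι : Type*} [Fintype ι] {F : Set (ι → ℝ)}
    (hF : IsCompact F) (h0 : volume F = 0) : torusHaar ι (torusMk '' F) = 0 := by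
  have hm : MeasurableSet (torusMk '' F) := (hF.image continuous_torusMk).isClosed.measurableSet
  rw [← measurePreserving_torusMk.measure_preimage hm.nullMeasurableSet]
  refine measure_mono_null ?_ (Measure.restrict_apply_eq_zero' (MeasurableSet.univ_pi
    fun _ => measurableSet_Ioc) |>.2 (measure_mono_null Set.inter_subset_left
    (measure_iUnion_null (s := fun z : ι → ℤ => (fun u => u + toReal z) ⁻¹' F) fun z => ?_)))
  · rintro u ⟨v, hv, hvu⟩
    obtain ⟨z, rfl⟩ := torusMk_eq_iff.1 hvu
    exact Set.mem_iUnion.2 ⟨z, hv⟩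
  · rw [measure_preimage_add_right, h0]

lemma frontier_preimage_subset {X Y : Type*} [TopologicalSpace X] [TopologicalSpace Y] (h : X → Y)
    (E : Set Y) : frontier (h ⁻¹' E) ⊆ {v | ¬ ContinuousAt h v} ∪ h ⁻¹' frontier E := by
  intro v hv
  by_cases hc : ContinuousAt h v
  · right
    rw [frontier_eq_closure_inter_closure] at hv
    rw [Set.mem_preimage, frontier_eq_closure_inter_closure]
    exact ⟨closure_mono (Set.image_preimage_subset _ _) (mem_closure_image hc hv.1),
      closure_mono (Set.image_preimage_subset h Eᶜ) (mem_closure_image hc hv.2)⟩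
  · exact Or.inl hc

lemma JordanMeasurable.isCompact_frontier {ι : Type*} [Fintype ι] {G : Set (ι → ℝ)}
    (hG : JordanMeasurable G) : IsCompact (frontier G) :=
  hG.1.isCompact_closure.of_isClosed_subset isClosed_frontier frontier_subset_closure

lemma JordanMeasurable.torusHaar_frontier_image {ι : Type*} [Fintype ι] {G : Set (ι → ℝ)}
    (hG : JordanMeasurable G) : torusHaar ι (frontier (torusMk '' G)) = 0 := by
  refine measure_mono_null ?_ (torusHaar_image_torusMk_eq_zero hG.isCompact_frontier hG.2)
  have h1 : closure (torusMk '' G) ⊆ torusMk '' closure G :=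
    closure_minimal (Set.image_mono subset_closure)
      (hG.1.isCompact_closure.image continuous_torusMk).isClosed
  have h2 : torusMk '' interior G ⊆ interior (torusMk '' G) :=
    isOpenMap_torusMk.image_interior_subset G
  rintro _ ⟨ht, ht'⟩
  obtain ⟨v, hv, rfl⟩ := h1 ht
  exact ⟨v, ⟨hv, fun hi => ht' (h2 ⟨v, hi, rfl⟩)⟩, rfl⟩

/-- Quasiperiodic sets are the sets of visits of the orbit `Λ x mod 1` to subsets of the torus with
null boundary. -/
lemma exists_torus_of_mem_quasiperiodicAlgebra {n : ℕ} {ι : Type*} [Fintype ι]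
    {Λ : Matrix ι (Fin n) ℝ} {A : Set (Fin n → ℤ)} (hA : A ∈ quasiperiodicAlgebra Λ) :
    ∃ E : Set (UnitAddTorus ι), torusHaar ι (frontier E) = 0 ∧
      A = {x | torusMk (Λ.mulVec (toReal x)) ∈ E} := by
  obtain ⟨G, -, hG, rfl⟩ := hA
  refine ⟨torusMk '' G, hG.torusHaar_frontier_image, ?_⟩
  ext x
  refine exists_congr fun g => and_congr_right fun _ => ?_
  rw [eq_comm, torusMk_eq_iff]

/-- Quasiperiodic sets remain quasiperiodic when rows are added to the matrix: one replaces `G` by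
the cylinder over `G`. -/
lemma quasiperiodicAlgebra_submatrix_subset {n : ℕ} {ι κ : Type*} [Fintype ι] [Fintype κ]
    (Λ : Matrix κ (Fin n) ℝ) {e : ι → κ} (he : Function.Injective e) :
    quasiperiodicAlgebra (Λ.submatrix e id) ⊆ quasiperiodicAlgebra Λ := by
  rintro _ ⟨G, hGc, hG, rfl⟩
  let ρ : (κ → ℝ) →ₗ[ℝ] (ι → ℝ) := LinearMap.funLeft ℝ ℝ e
  have hρc : Continuous ρ := ρ.continuous_of_finiteDimensional
  have hρ : ∀ F : Set (ι → ℝ), MeasurableSet F → volume F = 0 → volume (ρ ⁻¹' F) = 0 := by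
    intro F hF h0
    obtain ⟨c, -, hc⟩ := ρ.exists_map_addHaar_eq_smul_addHaar (volume : Measure (κ → ℝ))
      (volume : Measure (ι → ℝ)) (LinearMap.funLeft_surjective_of_injective ℝ ℝ e he)
    rw [← Measure.map_apply hρc.measurable hF, hc]
    simp [h0]
  have hconv : Convex ℝ (unitCube κ) := convex_pi fun _ _ => convex_Ico 0 1
  have hbdd : Bornology.IsBounded (unitCube κ) := by
    refine (Metric.isBounded_Icc (0 : κ → ℝ) 1).subset fun v hv => ?_
    exact ⟨fun i => (hv i trivial).1, fun i => (hv i trivial).2.le⟩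
  refine ⟨unitCube κ ∩ ρ ⁻¹' G, Set.inter_subset_left, ⟨hbdd.subset Set.inter_subset_left, ?_⟩, ?_⟩
  · refine measure_mono_null (frontier_inter_subset _ _) (measure_union_null
      (measure_mono_null Set.inter_subset_left (hconv.addHaar_frontier _))
      (measure_mono_null Set.inter_subset_right
        (measure_mono_null ?_ (hρ _ isClosed_frontier.measurableSet hG.2))))
    intro v hv
    rcases frontier_preimage_subset ρ G hv with h | h
    · exact absurd hρc.continuousAt h
    · exact h
  · ext x
    constructor
    · rintro ⟨g, hg, z, hz⟩
      have hz' : ∀ i, Λ.mulVec (toReal x) (e i) = g i + z i := fun i => congrFun hz i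
      refine ⟨fun k => Int.fract (Λ.mulVec (toReal x) k), ⟨fun k _ =>
        ⟨Int.fract_nonneg _, Int.fract_lt_one _⟩, ?_⟩, fun k => ⌊Λ.mulVec (toReal x) k⌋,
        funext fun k => (Int.fract_add_floor _).symm⟩
      have : ρ (fun k => Int.fract (Λ.mulVec (toReal x) k)) = g := by
        funext i
        have hgi := hGc hg i trivial
        change Int.fract (Λ.mulVec (toReal x) (e i)) = g i
        rw [hz', Int.fract_add_intCast, Int.fract_eq_self.2 hgi]
      rw [Set.mem_preimage, this]
      exact hg
    · rintro ⟨g, ⟨-, hg⟩, z, hz⟩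
      exact ⟨ρ g, hg, fun i => z (e i), funext fun i => congrFun hz (e i)⟩

/-! ### The quantization error -/

/-- The quantization error `u - R u`, which is `ℤⁿ`-periodic, as a function on the torus. -/
noncomputable def quantError {n : ℕ} (R : (Fin n → ℝ) → (Fin n → ℤ)) (t : UnitAddTorus (Fin n)) :
    Fin n → ℝ :=
  Function.surjInv torusMk_surjective t - toReal (R (Function.surjInv torusMk_surjective t))

lemma IsQuantizer.quantError_torusMk {n : ℕ} {R : (Fin n → ℝ) → (Fin n → ℤ)} (hR : IsQuantizer R)
    (u : Fin n → ℝ) : quantError R (torusMk u) = u - toReal (R u) := by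
  obtain ⟨z, hz⟩ := torusMk_eq_iff.1 (Function.surjInv_eq torusMk_surjective (torusMk u))
  unfold quantError
  rw [hz, hR.map_add]
  funext i
  simp [toReal]

lemma IsQuantizer.quantError_torusMk_of_mem {n : ℕ} {R : (Fin n → ℝ) → (Fin n → ℤ)}
    (hR : IsQuantizer R) {u : Fin n → ℝ} (hu : u ∈ R ⁻¹' {0}) : quantError R (torusMk u) = u := by
  rw [hR.quantError_torusMk, show R u = 0 from hu]
  funext i
  simp [toReal]

lemma IsQuantizer.exists_mem_cell {n : ℕ} {R : (Fin n → ℝ) → (Fin n → ℤ)} (hR : IsQuantizer R)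
    (t : UnitAddTorus (Fin n)) : ∃ u ∈ R ⁻¹' {0}, torusMk u = t := by
  obtain ⟨u, rfl⟩ := torusMk_surjective t
  refine ⟨u + toReal (-R u), ?_, torusMk_eq_iff.2 ⟨_, rfl⟩⟩
  rw [Set.mem_preimage, hR.map_add, add_neg_cancel, Set.mem_singleton_iff]

/-- Over the interior of the cell `R⁻¹(0)` the quantization error is a local inverse of the covering
map, so it can be discontinuous only over the boundary of the cell. -/
lemma IsQuantizer.ae_continuousAt_quantError {n : ℕ} {R : (Fin n → ℝ) → (Fin n → ℤ)}
    (hR : IsQuantizer R) : ∀ᵐ t ∂torusHaar (Fin n), ContinuousAt (quantError R) t := by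
  refine measure_mono_null ?_
    (torusHaar_image_torusMk_eq_zero hR.jordan.isCompact_frontier hR.jordan.2)
  intro t ht
  obtain ⟨u, hu, rfl⟩ := hR.exists_mem_cell t
  by_contra hnot
  have hint : u ∈ interior (R ⁻¹' {0}) := by
    by_contra h
    exact hnot ⟨u, ⟨subset_closure hu, h⟩, rfl⟩
  refine ht ?_
  change Tendsto (quantError R) (𝓝 (torusMk u)) (𝓝 (quantError R (torusMk u)))
  rw [hR.quantError_torusMk_of_mem hu, ← isOpenMap_torusMk.map_nhds_eq continuous_torusMk.continuousAt, tendsto_map'_iff]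
  refine tendsto_id.congr' ?_
  filter_upwards [mem_interior_iff_mem_nhds.1 hint] with v hv
  exact (hR.quantError_torusMk_of_mem hv).symm

/-! ### Equivariant maps between tori -/

lemma aemeasurable_of_ae_continuousAt {X Y : Type*} [TopologicalSpace X] [MeasurableSpace X]
    [OpensMeasurableSpace X] [PseudoEMetricSpace Y] [MeasurableSpace Y] [BorelSpace Y] {h : X → Y}
    {μ : Measure X} (hc : ∀ᵐ v ∂μ, ContinuousAt h v) : AEMeasurable h μ := by
  rw [← Measure.restrict_eq_self_of_ae_mem (s := {v | ContinuousAt h v}) hc]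
  exact ContinuousOn.aemeasurable (fun v hv => ContinuousAt.continuousWithinAt hv)
    (measurableSet_of_continuousAt h)

/-- If `h : X → W` is equivariant under the translations by `i w`, then its distribution is the
invariant measure of `W`, and `h` is independent of every set that is invariant under these
translations. This follows by averaging the measure of `B ∩ h⁻¹ E` over all translates. -/
lemma measure_inter_preimage_of_equivariant {X W : Type*} [AddGroup X] [MeasurableSpace X]
    [MeasurableAdd₂ X] [AddGroup W] [MeasurableSpace W] [MeasurableAdd W]
    {μ : Measure X} [SFinite μ] [μ.IsAddRightInvariant]
    {ν : Measure W} [IsProbabilityMeasure ν] [ν.IsAddLeftInvariant]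
    {i : W → X} (hi : Measurable i) {h : X → W} (hh : ∀ v w, h (v + i w) = h v + w)
    {B : Set X} (hB : ∀ v w, v + i w ∈ B ↔ v ∈ B) (hBm : NullMeasurableSet B μ) {E : Set W}
    (hE : NullMeasurableSet E ν)
    (hEm : NullMeasurableSet (h ⁻¹' E) μ) : μ (B ∩ h ⁻¹' E) = μ B * ν E := by
  set S := B ∩ h ⁻¹' E with hS
  have hSm : NullMeasurableSet S μ := hBm.inter hEm
  have hmeas : Measurable fun p : X × W => p.1 + i p.2 :=
    measurable_fst.add (hi.comp measurable_snd)
  have hq : Measure.QuasiMeasurePreserving (fun p : X × W => p.1 + i p.2) (μ.prod ν) μ := by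
    refine ⟨hmeas, Measure.AbsolutelyContinuous.mk fun s hs h0 => ?_⟩
    rw [Measure.map_apply hmeas hs, Measure.prod_apply_symm (hmeas hs)]
    have : ∀ w, μ ((fun v => (v, w)) ⁻¹' ((fun p : X × W => p.1 + i p.2) ⁻¹' s)) = 0 := fun w =>
      (measure_preimage_add_right μ (i w) s).trans h0
    simp [this]
  have hF : AEMeasurable (fun p : X × W => S.indicator (1 : X → ℝ≥0∞) (p.1 + i p.2))
      (μ.prod ν) :=
    (aemeasurable_one.indicator₀ hSm).comp_quasiMeasurePreserving hq
  calc μ S = ∫⁻ v, S.indicator 1 v ∂μ := (lintegral_indicator_one₀ hSm).symm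
    _ = ∫⁻ w, ∫⁻ v, S.indicator 1 (v + i w) ∂μ ∂ν := by
      have : ∀ w, ∫⁻ v, S.indicator (1 : X → ℝ≥0∞) (v + i w) ∂μ =
          ∫⁻ v, S.indicator 1 v ∂μ := fun w =>
        lintegral_add_right_eq_self (S.indicator (1 : X → ℝ≥0∞)) (i w)
      simp [this]
    _ = ∫⁻ v, ∫⁻ w, S.indicator 1 (v + i w) ∂ν ∂μ := (lintegral_lintegral_swap hF).symm
    _ = ∫⁻ v, B.indicator (fun _ => ν E) v ∂μ := by
      refine lintegral_congr fun v => ?_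
      by_cases hv : v ∈ B
      · have h1 : ∀ w, S.indicator (1 : X → ℝ≥0∞) (v + i w) =
            E.indicator 1 (h v + w) := fun w => by
          have : v + i w ∈ S ↔ h v + w ∈ E := by simp [hS, hB, hv, hh]
          by_cases hw : h v + w ∈ E <;> simp [Set.indicator, this, hw]
        simp only [h1, Set.indicator_of_mem hv]
        rw [lintegral_add_left_eq_self (E.indicator (1 : W → ℝ≥0∞)) (h v),
          lintegral_indicator_one₀ hE]
      · have h1 : ∀ w, S.indicator (1 : X → ℝ≥0∞) (v + i w) = 0 := fun w => by
          simp [hS, hB, hv]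
        simp [h1, hv]
    _ = μ B * ν E := by
      rw [lintegral_indicator₀ hBm]
      simp [mul_comm]

/-! ### The quantized system as a skew shift -/

/-- The skew shift on sequences in the torus; the orbit map `x ↦ (Lʲ⁺¹ x mod 1)_j` semiconjugates the
quantized system to it. -/
noncomputable def skewShift {n : ℕ} (R : (Fin n → ℝ) → (Fin n → ℤ)) (L : Matrix (Fin n) (Fin n) ℝ)
    (u : ℕ → UnitAddTorus (Fin n)) : ℕ → UnitAddTorus (Fin n) :=
  fun j => u (j + 1) - torusMk ((L ^ (j + 1)).mulVec (quantError R (u 0)))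

/-- The sequence `Lʲ⁺¹ x mod 1`, `j = 0, 1, 2, …`. -/
noncomputable def orbitSeq {n : ℕ} (L : Matrix (Fin n) (Fin n) ℝ) (x : Fin n → ℤ) :
    ℕ → UnitAddTorus (Fin n) :=
  fun j => torusMk ((L ^ (j + 1)).mulVec (toReal x))

/-- The semiconjugacy relation: `Lʲ⁺¹ T x = Lʲ⁺² x - Lʲ⁺¹ e`, where the quantization error
`e = L x - R (L x)` is a function of `L x mod 1`. -/
lemma IsQuantizer.semiconj_orbitSeq {n : ℕ} {R : (Fin n → ℝ) → (Fin n → ℤ)} (hR : IsQuantizer R)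
    (L : Matrix (Fin n) (Fin n) ℝ) :
    Function.Semiconj (orbitSeq L) (transition R L) (skewShift R L) := by
  intro x
  funext j
  have h0 : orbitSeq L x 0 = torusMk (L.mulVec (toReal x)) := by simp [orbitSeq]
  simp only [skewShift]
  rw [h0, hR.quantError_torusMk]
  simp only [orbitSeq, transition]
  rw [← torusMk_sub, Matrix.mulVec_sub, Matrix.mulVec_mulVec, ← pow_succ, sub_sub_cancel]

/-- A perturbation of the coordinates of index at least `k` enters additively into the `k`-th
iterate of the skew shift. -/
lemma skewShift_iterate_add {n : ℕ} (R : (Fin n → ℝ) → (Fin n → ℤ)) (L : Matrix (Fin n) (Fin n) ℝ)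
    (k : ℕ) (u s : ℕ → UnitAddTorus (Fin n)) (hs : ∀ i < k, s i = 0) (j : ℕ) :
    (skewShift R L)^[k] (u + s) j = (skewShift R L)^[k] u j + s (k + j) := by
  induction k generalizing u s with
  | zero => simp
  | succ k ih =>
    have h1 : skewShift R L (u + s) = skewShift R L u + fun i => s (i + 1) := by
      funext i
      change u (i + 1) + s (i + 1) - torusMk ((L ^ (i + 1)).mulVec (quantError R (u 0 + s 0))) =
        u (i + 1) - torusMk ((L ^ (i + 1)).mulVec (quantError R (u 0))) + s (i + 1)
      rw [hs 0 (Nat.succ_pos k), add_zero]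
      abel
    rw [Function.iterate_succ_apply, Function.iterate_succ_apply, h1,
      ih _ _ fun i hi => hs _ (Nat.succ_lt_succ hi)]
    congr 2
    omega

lemma skewShift_iterate_congr {n : ℕ} (R : (Fin n → ℝ) → (Fin n → ℤ))
    (L : Matrix (Fin n) (Fin n) ℝ) (k : ℕ) {u u' : ℕ → UnitAddTorus (Fin n)} {j : ℕ}
    (h : ∀ i ≤ k + j, u i = u' i) : (skewShift R L)^[k] u j = (skewShift R L)^[k] u' j := by
  induction k generalizing u u' j with
  | zero => exact h _ (by omega)
  | succ k ih =>
    rw [Function.iterate_succ_apply, Function.iterate_succ_apply]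
    refine ih fun i hi => ?_
    simp only [skewShift]
    rw [h 0 (by omega), h (i + 1) (by omega)]

/-- A finite sequence of points of the torus, continued by zero. -/
def toSeq {n : ℕ} (M : ℕ) (v : UnitAddTorus (Fin M × Fin n)) : ℕ → UnitAddTorus (Fin n) :=
  fun i c => if h : i < M then v (⟨i, h⟩, c) else 0

lemma continuous_toSeq {n : ℕ} (M : ℕ) :
    Continuous (toSeq M : UnitAddTorus (Fin M × Fin n) → ℕ → UnitAddTorus (Fin n)) := by
  refine continuous_pi fun i => continuous_pi fun c => ?_
  by_cases h : i < M
  · simpa only [toSeq, h, dite_true] using continuous_apply _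
  · simpa only [toSeq, h, dite_false] using continuous_const

lemma toSeq_add {n : ℕ} (M : ℕ) (v w : UnitAddTorus (Fin M × Fin n)) :
    toSeq M (v + w) = toSeq M v + toSeq M w := by
  funext i c
  by_cases h : i < M <;> simp [toSeq, h]

/-- The sequence `s`, written into the coordinates of index `k, k + 1, …`. -/
def insertFrom {n : ℕ} (M k : ℕ) (s : ℕ → UnitAddTorus (Fin n)) : UnitAddTorus (Fin M × Fin n) :=
  fun p => if k ≤ p.1 then s (p.1 - k) p.2 else 0

lemma continuous_insertFrom {n : ℕ} (M k : ℕ) :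
    Continuous (insertFrom M k : (ℕ → UnitAddTorus (Fin n)) → _) := by
  refine continuous_pi fun p => ?_
  by_cases h : k ≤ p.1
  · simp only [insertFrom, h, if_true]; fun_prop
  · simpa only [insertFrom, h, if_false] using continuous_const

lemma toSeq_insertFrom_of_lt {n M k i : ℕ} (s : ℕ → UnitAddTorus (Fin n)) (hi : i < k) :
    toSeq M (insertFrom M k s) i = 0 := by
  funext c
  by_cases h : i < M <;> simp [toSeq, insertFrom, h, hi]

lemma toSeq_insertFrom_add {n M k j : ℕ} (s : ℕ → UnitAddTorus (Fin n)) (hj : k + j < M) :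
    toSeq M (insertFrom M k s) (k + j) = s j := by
  funext c
  simp [toSeq, insertFrom, hj]

/-- The first `N` terms of the `k`-th iterate of the skew shift, as a map between tori. -/
noncomputable def block {n : ℕ} (R : (Fin n → ℝ) → (Fin n → ℤ)) (L : Matrix (Fin n) (Fin n) ℝ)
    (k M N : ℕ) (v : UnitAddTorus (Fin M × Fin n)) : UnitAddTorus (Fin N × Fin n) :=
  fun p => (skewShift R L)^[k] (toSeq M v) p.1 p.2

lemma skewShift_iterate_toSeq_add_insertFrom {n : ℕ} (R : (Fin n → ℝ) → (Fin n → ℤ))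
    (L : Matrix (Fin n) (Fin n) ℝ) {k M j : ℕ} (hj : k + j < M)
    (v : UnitAddTorus (Fin M × Fin n)) (s : ℕ → UnitAddTorus (Fin n)) :
    (skewShift R L)^[k] (toSeq M (v + insertFrom M k s)) j =
      (skewShift R L)^[k] (toSeq M v) j + s j := by
  rw [toSeq_add, skewShift_iterate_add _ _ _ _ _ fun i hi => toSeq_insertFrom_of_lt s hi,
    toSeq_insertFrom_add s hj]

lemma block_add_insertFrom {n : ℕ} (R : (Fin n → ℝ) → (Fin n → ℤ)) (L : Matrix (Fin n) (Fin n) ℝ)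
    {k M N : ℕ} (hM : k + N ≤ M) (v : UnitAddTorus (Fin M × Fin n))
    (w : UnitAddTorus (Fin N × Fin n)) :
    block R L k M N (v + insertFrom M k (toSeq N w)) = block R L k M N v + w := by
  funext p
  have hp := p.1.2
  simp only [block, Pi.add_apply]
  rw [skewShift_iterate_toSeq_add_insertFrom R L (by omega)]
  simp [toSeq]

/-- The iterates of the skew shift are almost everywhere continuous: the coordinate that is fed into
the quantization error at the next step is Haar distributed, by equivariance, and therefore almost
surely avoids the discontinuities. -/
lemma IsQuantizer.ae_continuousAt_iterate {n : ℕ} {R : (Fin n → ℝ) → (Fin n → ℤ)}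
    (hR : IsQuantizer R) (L : Matrix (Fin n) (Fin n) ℝ) {k M : ℕ} (hk : k ≤ M) :
    ∀ᵐ v ∂torusHaar (Fin M × Fin n),
      ContinuousAt (fun v => (skewShift R L)^[k] (toSeq M v)) v := by
  induction k with
  | zero => exact ae_of_all _ fun v => (continuous_toSeq M).continuousAt
  | succ k ih =>
    have ih := ih (by omega)
    set h : UnitAddTorus (Fin M × Fin n) → UnitAddTorus (Fin n) := fun v =>
      (skewShift R L)^[k] (toSeq M v) 0 with hh
    have hc : ∀ᵐ v ∂torusHaar (Fin M × Fin n), ContinuousAt h v :=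
      ih.mono fun v hv => (continuous_apply 0).continuousAt.comp hv
    have hD : MeasurableSet {t | ¬ ContinuousAt (quantError R) t} :=
      (measurableSet_of_continuousAt _).compl
    have hnull := measure_inter_preimage_of_equivariant (μ := torusHaar (Fin M × Fin n))
      (ν := torusHaar (Fin n)) (B := Set.univ) (h := h)
      (i := fun w => insertFrom M k fun _ => w)
      ((continuous_insertFrom M k).comp (by fun_prop)).measurable
      (fun v w => skewShift_iterate_toSeq_add_insertFrom R L (by omega) v _)
      (fun v w => by simp) MeasurableSet.univ.nullMeasurableSet hD.nullMeasurableSet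
      ((aemeasurable_of_ae_continuousAt hc).nullMeasurableSet_preimage hD)
    rw [Set.univ_inter, show torusHaar (Fin n) {t | ¬ ContinuousAt (quantError R) t} = 0 from
      hR.ae_continuousAt_quantError, mul_zero] at hnull
    have hq : ∀ᵐ v ∂torusHaar (Fin M × Fin n), ContinuousAt (quantError R) (h v) := hnull
    filter_upwards [ih, hq] with v hv hqv
    simp only [Function.iterate_succ_apply']
    refine continuousAt_pi.2 fun j => ?_
    have h1 : ∀ i, ContinuousAt (fun v => (skewShift R L)^[k] (toSeq M v) i) v :=
      continuousAt_pi.1 hv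
    have h2 : ContinuousAt (fun v => quantError R (h v)) v :=
      ContinuousAt.comp (f := h) hqv (h1 0)
    have h3 : Continuous fun e : Fin n → ℝ => torusMk ((L ^ (j + 1)).mulVec e) :=
      continuous_torusMk.comp (Continuous.matrix_mulVec continuous_const continuous_id)
    exact (h1 (j + 1)).sub (h3.continuousAt.comp h2)

lemma IsQuantizer.ae_continuousAt_block {n : ℕ} {R : (Fin n → ℝ) → (Fin n → ℤ)}
    (hR : IsQuantizer R) (L : Matrix (Fin n) (Fin n) ℝ) {k M : ℕ} (N : ℕ) (hk : k ≤ M) :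
    ∀ᵐ v ∂torusHaar (Fin M × Fin n), ContinuousAt (block R L k M N) v := by
  filter_upwards [hR.ae_continuousAt_iterate L hk] with v hv
  refine continuousAt_pi.2 fun p => ?_
  exact continuousAt_pi.1 (continuousAt_pi.1 hv p.1) p.2

/-- The block map preserves Haar measure, and it is independent of the sets that do not depend on
the coordinates of index at least `k`. -/
lemma torusHaar_inter_block_preimage {n : ℕ} (R : (Fin n → ℝ) → (Fin n → ℤ))
    (L : Matrix (Fin n) (Fin n) ℝ) {k M N : ℕ} (hM : k + N ≤ M)
    {B : Set (UnitAddTorus (Fin M × Fin n))} (hB : ∀ v s, v + insertFrom M k s ∈ B ↔ v ∈ B)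
    (hBm : NullMeasurableSet B (torusHaar (Fin M × Fin n)))
    {E : Set (UnitAddTorus (Fin N × Fin n))} (hE : NullMeasurableSet E (torusHaar _))
    (hEm : NullMeasurableSet (block R L k M N ⁻¹' E) (torusHaar _)) :
    torusHaar _ (B ∩ block R L k M N ⁻¹' E) = torusHaar _ B * torusHaar _ E :=
  measure_inter_preimage_of_equivariant (i := fun w => insertFrom M k (toSeq N w))
    ((continuous_insertFrom M k).comp (continuous_toSeq N)).measurable
    (block_add_insertFrom R L hM) (fun v _ => hB v _) hBm hE hEm

lemma IsQuantizer.torusHaar_frontier_block_preimage {n : ℕ} {R : (Fin n → ℝ) → (Fin n → ℤ)}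
    (hR : IsQuantizer R) (L : Matrix (Fin n) (Fin n) ℝ) {k M N : ℕ} (hM : k + N ≤ M)
    {E : Set (UnitAddTorus (Fin N × Fin n))} (hE : torusHaar _ (frontier E) = 0) :
    torusHaar _ (frontier (block R L k M N ⁻¹' E)) = 0 := by
  have hc := hR.ae_continuousAt_block L N (k := k) (M := M) (by omega)
  refine measure_mono_null (frontier_preimage_subset _ _) (measure_union_null hc ?_)
  have hF : MeasurableSet (frontier E) := isClosed_frontier.measurableSet
  have := torusHaar_inter_block_preimage R L hM (B := Set.univ) (fun v s => by simp)
    MeasurableSet.univ.nullMeasurableSet hF.nullMeasurableSet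
    ((aemeasurable_of_ae_continuousAt hc).nullMeasurableSet_preimage hF)
  rwa [hE, mul_zero, Set.univ_inter] at this

/-! ### Quasiperiodic sets of the forward algebra -/

lemma IterativelyNonresonant.nonresonant_forwardBlock {n : ℕ} {L : Matrix (Fin n) (Fin n) ℝ}
    (hL : IterativelyNonresonant L) {M : ℕ} (hM : 1 ≤ M) : Nonresonant (forwardBlock L M) := by
  rcases Nat.eq_zero_or_pos n with rfl | hn
  · exact linearIndependent_empty_type
  let e : Fin M × Fin n → {k : ℤ // k ≠ 0} × Fin n := fun p =>
    (⟨((p.1 : ℕ) + 1 : ℕ), by positivity⟩, p.2)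
  have he : Function.Injective e := by
    rintro ⟨a, c⟩ ⟨b, d⟩ h
    simp only [e, Prod.mk.injEq, Subtype.mk.injEq, Nat.cast_inj, add_left_inj] at h
    exact Prod.ext (Fin.ext h.1) h.2
  let q : Fin M × Fin n ≃ Fin (M * n) := finProdFinEquiv
  have h := hL.2 (M * n) (Nat.mul_pos hM hn) (q.symm.toEmbedding.trans ⟨e, he⟩)
  have h2 := LinearIndependent.comp h (Sum.map id q) (Function.injective_id.sumMap q.injective)
  unfold Nonresonant
  convert h2 using 1
  funext i
  rcases i with j | p
  · rfl
  · funext j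
    change (L ^ ((p.1 : ℕ) + 1)) p.2 j = (powerMatrix L) (e (q.symm (q p))) j
    rw [Equiv.symm_apply_apply]
    change _ = (L ^ ((((p.1 : ℕ) + 1 : ℕ) : ℤ))) p.2 j
    rw [zpow_natCast]

lemma eventually_mem_forwardAlgebraUpTo {n : ℕ} {L : Matrix (Fin n) (Fin n) ℝ}
    {A : Set (Fin n → ℤ)} (hA : A ∈ forwardAlgebra L) :
    ∀ᶠ N in atTop, A ∈ forwardAlgebraUpTo L N := by
  obtain ⟨m, -, e, hA⟩ := hA
  filter_upwards [eventually_ge_atTop (∑ i, ((e i).1 : ℕ))] with N hN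
  have hb : ∀ i, ((e i).1 : ℕ) - 1 < N := fun i => by
    have h1 := Finset.single_le_sum (f := fun i => ((e i).1 : ℕ)) (fun _ _ => Nat.zero_le _)
      (Finset.mem_univ i)
    have h2 := (e i).1.pos
    omega
  let f : Fin m → Fin N × Fin n := fun i => (⟨((e i).1 : ℕ) - 1, hb i⟩, (e i).2)
  have hf : Function.Injective f := by
    intro i j h
    simp only [f, Prod.mk.injEq, Fin.mk.injEq] at h
    have hi := (e i).1.pos
    have hj := (e j).1.pos
    exact e.injective (Prod.ext (PNat.coe_injective (by omega)) h.2)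
  refine quasiperiodicAlgebra_submatrix_subset (forwardBlock L N) hf ?_
  convert hA using 2
  ext i j
  have hi := (e i).1.pos
  change (L ^ (((e i).1 : ℕ) - 1 + 1)) (e i).2 j = (L ^ ((e i).1 : ℕ)) (e i).2 j
  rw [Nat.sub_add_cancel hi]

/-- The point of the torus that decides to which sets of `𝒬⁺_N` the lattice point `x` belongs. -/
noncomputable def torusPoint {n : ℕ} (L : Matrix (Fin n) (Fin n) ℝ) (N : ℕ) (x : Fin n → ℤ) :
    UnitAddTorus (Fin N × Fin n) :=
  torusMk ((forwardBlock L N).mulVec (toReal x))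

lemma torusPoint_apply {n : ℕ} (L : Matrix (Fin n) (Fin n) ℝ) (N : ℕ) (x : Fin n → ℤ)
    (p : Fin N × Fin n) : torusPoint L N x p = orbitSeq L x p.1 p.2 := rfl

lemma IsQuantizer.block_torusPoint {n : ℕ} {R : (Fin n → ℝ) → (Fin n → ℤ)}
    (hR : IsQuantizer R) (L : Matrix (Fin n) (Fin n) ℝ) {k M N : ℕ} (hM : k + N ≤ M)
    (x : Fin n → ℤ) :
    block R L k M N (torusPoint L M x) = torusPoint L N ((transition R L)^[k] x) := by
  funext p
  have hp := p.1.2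
  rw [torusPoint_apply, (hR.semiconj_orbitSeq L).iterate_right k x]
  unfold block
  rw [skewShift_iterate_congr]
  intro i hi
  funext c
  have : i < M := by omega
  simp only [toSeq, this, dite_true, torusPoint_apply]

/-- A set of the forward algebra, as the set of visits of `torusPoint` to a null boundary set. -/
lemma exists_torusPoint_preimage {n : ℕ} {L : Matrix (Fin n) (Fin n) ℝ} {N : ℕ}
    {A : Set (Fin n → ℤ)} (hA : A ∈ forwardAlgebraUpTo L N) :
    ∃ E : Set (UnitAddTorus (Fin N × Fin n)), torusHaar _ (frontier E) = 0 ∧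
      A = torusPoint L N ⁻¹' E :=
  exists_torus_of_mem_quasiperiodicAlgebra hA

lemma IterativelyNonresonant.hasUniformFrequency {n : ℕ} {L : Matrix (Fin n) (Fin n) ℝ}
    (hL : IterativelyNonresonant L) {N : ℕ} (hN : 1 ≤ N) {E : Set (UnitAddTorus (Fin N × Fin n))}
    (hE : torusHaar _ (frontier E) = 0) :
    HasUniformFrequency (torusPoint L N ⁻¹' E) (torusHaar _ E).toReal :=
  hasUniformFrequency_of_nonresonant (hL.nonresonant_forwardBlock hN) hE

/-- All the sets `T⁻ᵏ A ∩ B` have a frequency, and it factorizes as soon as `T⁻ᵏ A` and `B` are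
governed by disjoint groups of coordinates. -/
lemma hasUniformFrequency_preimage_inter {n : ℕ} {R : (Fin n → ℝ) → (Fin n → ℤ)}
    (hR : IsQuantizer R) {L : Matrix (Fin n) (Fin n) ℝ} (hL : IterativelyNonresonant L) {N : ℕ}
    (hN : 1 ≤ N) {E F : Set (UnitAddTorus (Fin N × Fin n))} (hE : torusHaar _ (frontier E) = 0)
    (hF : torusHaar _ (frontier F) = 0) (k : ℕ) :
    ∃ c, HasUniformFrequency
        ((transition R L)^[k] ⁻¹' (torusPoint L N ⁻¹' E) ∩ torusPoint L N ⁻¹' F) c ∧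
      (N ≤ k → c = (torusHaar _ E).toReal * (torusHaar _ F).toReal) := by
  -- `T⁻ᵏ A` depends on the coordinates of index below `k + N` only
  set M := k + N
  have hk : k + N ≤ M := le_rfl
  have h0 : 0 + N ≤ M := by omega
  set B := block R L 0 M N ⁻¹' F
  have hBf : torusHaar _ (frontier B) = 0 := hR.torusHaar_frontier_block_preimage L h0 hF
  have hAf : torusHaar _ (frontier (block R L k M N ⁻¹' E)) = 0 :=
    hR.torusHaar_frontier_block_preimage L hk hE
  have hf : torusHaar _ (frontier (B ∩ block R L k M N ⁻¹' E)) = 0 :=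
    measure_mono_null (frontier_inter_subset _ _) (measure_union_null
      (measure_mono_null Set.inter_subset_left hBf) (measure_mono_null Set.inter_subset_right hAf))
  have hset : (transition R L)^[k] ⁻¹' (torusPoint L N ⁻¹' E) ∩ torusPoint L N ⁻¹' F =
      torusPoint L M ⁻¹' (B ∩ block R L k M N ⁻¹' E) := by
    ext x
    simp only [B, Set.mem_inter_iff, Set.mem_preimage, hR.block_torusPoint L hk,
      hR.block_torusPoint L h0, Function.iterate_zero, id, and_comm]
  refine ⟨_, hset ▸ hL.hasUniformFrequency (by omega) hf, fun hNk => ?_⟩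
  have hB : ∀ v s, v + insertFrom M k s ∈ B ↔ v ∈ B := by
    intro v s
    have : block R L 0 M N (v + insertFrom M k s) = block R L 0 M N v := by
      funext p
      have hp : (p.1 : ℕ) < k := p.1.2.trans_le hNk
      simp only [block, Function.iterate_zero, id, toSeq_add]
      rw [Pi.add_apply, toSeq_insertFrom_of_lt s hp, add_zero]
    simp only [B, Set.mem_preimage, this]
  have hFB : torusHaar _ B = torusHaar _ F := by
    have := torusHaar_inter_block_preimage R L h0 (B := Set.univ) (fun v s => by simp)
      MeasurableSet.univ.nullMeasurableSet (nullMeasurableSet_of_null_frontier hF)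
      (nullMeasurableSet_of_null_frontier hBf)
    rwa [Set.univ_inter, measure_univ, one_mul] at this
  rw [torusHaar_inter_block_preimage R L hk hB (nullMeasurableSet_of_null_frontier hBf)
    (nullMeasurableSet_of_null_frontier hE) (nullMeasurableSet_of_null_frontier hAf), hFB,
    ENNReal.toReal_mul, mul_comm]

/-- The factorization of frequencies on `𝒬⁺_N`. -/
theorem frequency_preimage_inter {n : ℕ} {R : (Fin n → ℝ) → (Fin n → ℤ)}
    (hR : IsQuantizer R) {L : Matrix (Fin n) (Fin n) ℝ} (hL : IterativelyNonresonant L) {N : ℕ}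
    (hN : 1 ≤ N) {A B : Set (Fin n → ℤ)} (hA : A ∈ forwardAlgebraUpTo L N)
    (hB : B ∈ forwardAlgebraUpTo L N) :
    FrequencyMeasurable A ∧ FrequencyMeasurable B ∧
      ∀ k : ℕ, FrequencyMeasurable ((transition R L)^[k] ⁻¹' A ∩ B) ∧
        (N ≤ k → frequency ((transition R L)^[k] ⁻¹' A ∩ B) = frequency A * frequency B) := by
  obtain ⟨E, hE, rfl⟩ := exists_torusPoint_preimage hA
  obtain ⟨F, hF, rfl⟩ := exists_torusPoint_preimage hB
  have h1 := (hL.hasUniformFrequency hN hE).frequency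
  have h2 := (hL.hasUniformFrequency hN hF).frequency
  refine ⟨h1.1, h2.1, fun k => ?_⟩
  obtain ⟨c, hc, hprod⟩ := hasUniformFrequency_preimage_inter hR hL hN hE hF k
  refine ⟨hc.frequency.1, fun hk => ?_⟩
  rw [hc.frequency.2, h1.2, h2.2, hprod hk]

end QuantizedLinear

open QuantizedLinear in
theorem mainTheorem5 (n : ℕ) (R : (Fin n → ℝ) → (Fin n → ℤ)) (hR : IsQuantizer R)
    (L : Matrix (Fin n) (Fin n) ℝ) (hL : IterativelyNonresonant L) :
    -- all sets of the forward algebra have a frequency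
    (∀ A ∈ forwardAlgebra L, FrequencyMeasurable A) ∧
    -- mixing on the forward algebra
    (∀ A ∈ forwardAlgebra L, ∀ B ∈ forwardAlgebra L,
      (∀ k : ℕ, FrequencyMeasurable (((transition R L)^[k]) ⁻¹' A ∩ B)) ∧
      Filter.Tendsto (fun k : ℕ => frequency (((transition R L)^[k]) ⁻¹' A ∩ B))
        Filter.atTop (nhds (frequency A * frequency B))) ∧
    -- any two sets of the forward algebra lie in one of the algebras generated by `L, …, L ^ N`
    (∀ A ∈ forwardAlgebra L, ∀ B ∈ forwardAlgebra L,
      ∃ N : ℕ, 1 ≤ N ∧ A ∈ forwardAlgebraUpTo L N ∧ B ∈ forwardAlgebraUpTo L N) ∧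
    -- for such sets the limit is attained as soon as `k ≥ N`
    (∀ N : ℕ, 1 ≤ N → ∀ A ∈ forwardAlgebraUpTo L N, ∀ B ∈ forwardAlgebraUpTo L N,
      FrequencyMeasurable A ∧ FrequencyMeasurable B ∧
      ∀ k : ℕ, N ≤ k →
        FrequencyMeasurable (((transition R L)^[k]) ⁻¹' A ∩ B) ∧
        frequency (((transition R L)^[k]) ⁻¹' A ∩ B) = frequency A * frequency B) := by
  have hcommon : ∀ A ∈ forwardAlgebra L, ∀ B ∈ forwardAlgebra L,
      ∃ N : ℕ, 1 ≤ N ∧ A ∈ forwardAlgebraUpTo L N ∧ B ∈ forwardAlgebraUpTo L N :=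
    fun A hA B hB => ((Filter.eventually_ge_atTop 1).and
      ((eventually_mem_forwardAlgebraUpTo hA).and (eventually_mem_forwardAlgebraUpTo hB))).exists
  refine ⟨fun A hA => ?_, fun A hA B hB => ?_, hcommon, fun N hN A hA B hB => ?_⟩
  · obtain ⟨N, hN, hAN, -⟩ := hcommon A hA A hA
    exact (frequency_preimage_inter hR hL hN hAN hAN).1
  · obtain ⟨N, hN, hAN, hBN⟩ := hcommon A hA B hB
    obtain ⟨-, -, h⟩ := frequency_preimage_inter hR hL hN hAN hBN
    refine ⟨fun k => (h k).1, tendsto_const_nhds.congr' ?_⟩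
    filter_upwards [Filter.eventually_ge_atTop N] with k hk
    exact ((h k).2 hk).symm
  · obtain ⟨h1, h2, h⟩ := frequency_preimage_inter hR hL hN hA hB
    exact ⟨h1, h2, fun k hk => ⟨(h k).1, (h k).2 hk⟩⟩
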